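/- Let $m,n\ge 0$. Mark $2(m+n)$ points on the boundary of a rectangle: $x_1,\dots,x_n$ on the top side and $x'_1,\dots,x'_n$ on the bottom side (from left to right), $y_1,\dots,y_m$ on the left side and $y'_1,\dots,y'_m$ on the right side (from top to bottom). A Catalan state $C\in\mathrm{Cat}(m,n)$ is a system of $m+n$ disjoint arcs embedded in the rectangle that join these points in pairs, considered up to isotopy. It has no bottom returns if no arc of $C$ joins two points of the bottom side. The lattice crossing $L(m,n)$ consists of $m$ horizontal lines (the $j$-th one from $y_j$ to $y'_j$) and $n$ vertical lines (the $i$-th one from $x_i$ to $x'_i$). A Kauffman state $s$ of $L(m,n)$ assigns a marker $+1$ or $-1$ to each of the $mn$ crossings. A crossing with marker $+1$ is smoothed so that its upper segment is joined to its right one and its left segment to its lower one; a crossing with marker $-1$ is smoothed so that its upper segment is joined to its left one and its right segment to its lower one. Let $C_s\in\mathrm{Cat}(m,n)$ be the Catalan state that remains when the closed components of the smoothed diagram are removed. The state $s$ realizes $C$ if $C_s=C$, and $C$ is realizable if some Kauffman state realizes it. For a sequence $\mathbf b=(b_1,\dots,b_m)$ of integers with $0\le b_j\le n$, consider the Kauffman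 state whose markers in the $j$-th row from the top are, from left to right, $b_j$ times $+1$ followed by $n-b_j$ times $-1$. Let $\mathfrak b(C)$ be the set of those $\mathbf b$ whose Kauffman state realizes $C$, and let $\Vert\mathbf b\Vert=b_1+\dots+b_m$ and $$\beta(C)=\max\{\Vert\mathbf b\Vert:\mathbf b\in\mathfrak b(C)\}.$$ Define $\iota_{m,n}(x_i)=i-n$ for $1\le i\le n$, and $\iota_{m,n}(y'_j)=j$ and $\iota_{m,n}(y_j)=-n+1-j$ for $1\le j\le m$. Let $S(C)$ be the set of the arcs of $C$ with no end on the bottom side, each written as $(p,q)$ with $\iota_{m,n}(p)<\iota_{m,n}(q)$. Let $C\in\mathrm{Cat}(m,n)$ be a realizable Catalan state with no bottom returns. Then $\mathfrak b(C)$ is non-empty, so that the maximum $\beta(C)$ exists, and $$\beta(C)=mn+\frac{m(m-1)}{2}+\sum_{(p,q)\in S(C)}\min\{\iota_{m,n}(p),\,1-\iota_{m,n}(q)\}.$$ -/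

import Mathlib

namespace LatticeCrossing

/-- The `2(m+n)` boundary points of the rectangle with `m` points on each vertical side and `n`
points on each horizontal side. With indices starting from `0`, `top i` is `x_{i+1}` and `bottom i`
is `x'_{i+1}` (numbered from left to right), `left j` is `y_{j+1}` and `right j` is `y'_{j+1}`
(numbered from top to bottom). -/
inductive BPoint (m n : ℕ) : Type
  | top (i : Fin n)
  | bottom (i : Fin n)
  | left (j : Fin m)
  | right (j : Fin m)
  deriving DecidableEq, Fintype

namespace BPoint

/-- The point lies on the bottom side. -/
def IsBottom {m n : ℕ} : BPoint m n → Prop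
  | bottom _ => True
  | _ => False

instance {m n : ℕ} : DecidablePred (IsBottom (m := m) (n := n))
  | top _ => isFalse id
  | bottom _ => isTrue trivial
  | left _ => isFalse id
  | right _ => isFalse id

/-- The position `0, 1, …, 2(m+n)-1` of a point when the boundary of the rectangle is traversed
clockwise starting from the lower left corner: up the left side, along the top side, down the right
side, back along the bottom side. -/
def pos {m n : ℕ} : BPoint m n → ℕ
  | left j => m - 1 - j
  | top i => m + i
  | right j => m + n + j
  | bottom i => m + n + m + (n - 1 - i)

/-- The coordinate function `ι_{m,n}`: `x_i ↦ i - n`, `y'_j ↦ j`, `y_j ↦ -n + 1 - j` (these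
indices start from `1`, those in the code from `0`). It is meaningful only for points not on the
bottom side; the value `0` at bottom points is never used. -/
def iota {m n : ℕ} : BPoint m n → ℤ
  | top i => (i + 1 : ℤ) - n
  | right j => (j + 1 : ℤ)
  | left j => -(n : ℤ) + 1 - (j + 1)
  | bottom _ => 0

end BPoint

/-- A Catalan state in `Cat(m,n)`: a crossingless connection of the `2(m+n)` boundary points of
the rectangle (up to isotopy), that is, a fixed-point-free involution `mate` of the boundary points
(`mate p` is the other end of the arc that starts at `p`) no two of whose arcs cross. -/
structure CatalanState (m n : ℕ) where
  mate : BPoint m n → BPoint m n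
  mate_mate : ∀ p, mate (mate p) = p
  mate_ne : ∀ p, mate p ≠ p
  noncrossing : ∀ p q, ¬ (p.pos < q.pos ∧ q.pos < (mate p).pos ∧ (mate p).pos < (mate q).pos)

/-- Positive and negative markers. -/
inductive Marker : Type
  | plus
  | minus

/-- A Kauffman state of the lattice crossing `L(m,n)`: a marker for each crossing. The crossing
`(j, i)` is the one in row `j` (from the top) and column `i` (from the left). -/
abbrev KauffmanState (m n : ℕ) : Type := Fin m → Fin n → Marker

/-- The segments into which the crossings divide the lines of `L(m,n)`: `hor j i` is the
`i`-th segment (from the left) of the `j`-th horizontal line and `ver j i` is the `j`-th segment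
(from the top) of the `i`-th vertical line. So the crossing `(j, i)` meets the segments `hor j i` on
its left, `hor j (i+1)` on its right, `ver j i` above and `ver (j+1) i` below it. -/
inductive Segment (m n : ℕ) : Type
  | hor (j : Fin m) (i : Fin (n + 1))
  | ver (j : Fin (m + 1)) (i : Fin n)

/-- The segment on which a boundary point lies. -/
def BPoint.segment {m n : ℕ} : BPoint m n → Segment m n
  | .top i => .ver 0 i
  | .bottom i => .ver (Fin.last m) i
  | .left j => .hor j 0
  | .right j => .hor j (Fin.last n)

/-- Two segments are joined directly by the smoothing of a crossing. At a crossing with a positive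
marker, the segment above is joined to the one on the right, and the one on the left to the one
below; at a crossing with a negative marker, the segment above is joined to the one on the left, and
the one on the right to the one below. -/
inductive Smoothing {m n : ℕ} (s : KauffmanState m n) : Segment m n → Segment m n → Prop
  | plus_above_right (j : Fin m) (i : Fin n) (h : s j i = .plus) :
      Smoothing s (.ver j.castSucc i) (.hor j i.succ)
  | plus_left_below (j : Fin m) (i : Fin n) (h : s j i = .plus) :
      Smoothing s (.hor j i.castSucc) (.ver j.succ i)
  | minus_above_left (j : Fin m) (i : Fin n) (h : s j i = .minus) :
      Smoothing s (.ver j.castSucc i) (.hor j i.castSucc)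
  | minus_right_below (j : Fin m) (i : Fin n) (h : s j i = .minus) :
      Smoothing s (.hor j i.succ) (.ver j.succ i)

/-- Two segments lie on the same component of the smoothed diagram `D_s`. -/
def SameComponent {m n : ℕ} (s : KauffmanState m n) : Segment m n → Segment m n → Prop :=
  Relation.EqvGen (Smoothing s)

/-- `s` realizes `C`, that is, `C = C_s`: the arcs of `C` join exactly the pairs of distinct
boundary points that lie on the same component of `D_s`. (Closed components of `D_s` contain no
boundary points, so they are discarded.) -/
def KauffmanState.Realizes {m n : ℕ} (s : KauffmanState m n) (C : CatalanState m n) : Prop :=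
  ∀ p q, C.mate p = q ↔ p ≠ q ∧ SameComponent s p.segment q.segment

/-- The Kauffman state of a sequence `b = (b_1, …, b_m)` with `0 ≤ b_j ≤ n`: in the `j`-th row, the
first `b_j` markers are positive and the remaining `n - b_j` are negative. -/
def rowState {m n : ℕ} (b : Fin m → Fin (n + 1)) : KauffmanState m n :=
  fun j i => if (i : ℕ) < (b j : ℕ) then .plus else .minus

namespace CatalanState

variable {m n : ℕ}

/-- `C` is realizable: it is `C_s` for some Kauffman state `s` of `L(m,n)`. -/
def Realizable (C : CatalanState m n) : Prop :=
  ∃ s : KauffmanState m n, KauffmanState.Realizes s C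

/-- `C` has no bottom returns: no arc of `C` joins two bottom points. -/
def NoBottomReturns (C : CatalanState m n) : Prop :=
  ∀ p, p.IsBottom → ¬ (C.mate p).IsBottom

/-- The set `𝔟(C)` of the sequences `b` that realize `C`. -/
def realizingSequences (C : CatalanState m n) : Set (Fin m → Fin (n + 1)) :=
  {b | (rowState b).Realizes C}

/-- The set of the sums `‖b‖ = b_1 + ⋯ + b_m` for `b ∈ 𝔟(C)`. -/
def markerSums (C : CatalanState m n) : Set ℕ :=
  (fun b : Fin m → Fin (n + 1) => ∑ j, (b j : ℕ)) '' C.realizingSequences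

/-- `β(C) = max {‖b‖ : b ∈ 𝔟(C)}`. -/
noncomputable def beta (C : CatalanState m n) : ℕ :=
  sSup C.markerSums

/-- The set `S(C)` of the arcs of `C` with no end on the bottom side. Each arc is listed once, as
the pair `(p, q)` of its left end and its right end, so `ι(p) < ι(q)`. -/
def upperArcs (C : CatalanState m n) : Finset (BPoint m n × BPoint m n) :=
  Finset.univ.filter fun a =>
    C.mate a.1 = a.2 ∧ ¬ a.1.IsBottom ∧ ¬ a.2.IsBottom ∧ a.1.iota < a.2.iota

end CatalanState

end LatticeCrossing

namespace LatticeCrossing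

/-! The proof is by induction on the number of rows, peeling off the top one. A row of `b` positive
markers followed by negative ones has a single cap, joining the neighbouring points `b` and `b + 1`
of `firstRow`; it passes the other `n` points down in order. So a sequence realizes `C` exactly when
its first entry marks a cap of `C` and its tail realizes the state `C'` left after removing that cap
(`realizes_iff_of_isPeeling`).

The claimed value is `betaValue`. Peeling a cap at `b` moves ι by one, in opposite directions on the
two sides of the cap. Comparing the sums over upper arcs term by term gives `C'.betaValue + b ≤
C.betaValue` (`betaValue_le`), hence the upper bound. For the rightmost cap equality holds
(`IsRightmostCap.betaValue_eq`), because the points under an arc to its right cannot be matched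
within the first row. Always peeling the rightmost cap therefore attains the bound.

A cap is always available: a horizontal line between rows is crossed by at most `n` arcs of a
realizable state, while `firstRow` has `n + 2` points. This `CutBound` survives peeling, so it
replaces realizability as the induction hypothesis. -/

variable {m n : ℕ}

/-! ### Boundary points before and after a top row is inserted -/

/-- The `n + 2` points at which the top row of `L(m+1,n)` is entered from the left, from above and
from the right, in clockwise order. -/
def firstRow (r : Fin (n + 2)) : BPoint (m + 1) n :=
  if (r : ℕ) = 0 then .left 0
  else if h : (r : ℕ) - 1 < n then .top ⟨r - 1, h⟩
  else .right 0

/-- The embedding of the boundary points of `L(m,n)` into those of `L(m+1,n)` given by a top row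
that joins the `b`-th and the `(b+1)`-st point of `firstRow` and moves the other ones down. -/
def lift (b : Fin (n + 1)) : BPoint m n → BPoint (m + 1) n
  | .left j => .left j.succ
  | .right j => .right j.succ
  | .bottom i => .bottom i
  | .top i => if (i : ℕ) < b then firstRow i.castSucc.castSucc else firstRow i.succ.succ

lemma BPoint.pos_eq {m n : ℕ} (p : BPoint m n) (hp : ¬ p.IsBottom) :
    (p.pos : ℤ) = p.iota + (n + m - 1) := by
  rcases p with i | i | j | j <;> simp [BPoint.IsBottom, BPoint.pos, BPoint.iota] at * <;> omega

lemma BPoint.pos_lt_of_isBottom {m n : ℕ} {p q : BPoint m n} (hp : ¬ p.IsBottom)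
    (hq : q.IsBottom) : p.pos < q.pos := by
  rcases p with i | i | j | j <;> rcases q with i' | i' | j' | j' <;>
    simp [BPoint.IsBottom, BPoint.pos] at * <;> omega

lemma BPoint.pos_injective : Function.Injective (BPoint.pos : BPoint m n → ℕ) := by
  intro p q h
  rcases p with i | i | j | j <;> rcases q with i' | i' | j' | j' <;>
    simp only [BPoint.pos] at h <;> first | omega | (congr 1; ext; omega)

lemma pos_firstRow (r : Fin (n + 2)) : (firstRow r : BPoint (m + 1) n).pos = m + r := by
  have := r.isLt
  unfold firstRow
  split_ifs <;> simp only [BPoint.pos, Fin.val_zero] <;> omega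

lemma not_isBottom_firstRow (r : Fin (n + 2)) : ¬ (firstRow r : BPoint (m + 1) n).IsBottom := by
  unfold firstRow
  split_ifs <;> simp [BPoint.IsBottom]

lemma iota_firstRow (r : Fin (n + 2)) : (firstRow r : BPoint (m + 1) n).iota = r - n := by
  have := BPoint.pos_eq _ (not_isBottom_firstRow (m := m) r)
  rw [pos_firstRow] at this
  push_cast at this
  omega

lemma firstRow_injective : Function.Injective (firstRow : Fin (n + 2) → BPoint (m + 1) n) := by
  intro r r' h
  have := congrArg BPoint.pos h
  rw [pos_firstRow, pos_firstRow] at this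
  ext; omega

lemma isBottom_lift (b : Fin (n + 1)) (p : BPoint m n) : (lift b p).IsBottom ↔ p.IsBottom := by
  rcases p with i | i | j | j <;> simp only [lift]
  · have h : ¬ (BPoint.top i : BPoint m n).IsBottom := id
    split_ifs <;> simp [not_isBottom_firstRow, h]
  all_goals simp [BPoint.IsBottom]

lemma pos_lift (b : Fin (n + 1)) (p : BPoint m n) :
    (lift b p).pos = if p.pos < m + b then p.pos else p.pos + 2 := by
  have := b.isLt
  rcases p with i | i | j | j
  · have h0 : (BPoint.top i : BPoint m n).pos = m + i := rfl
    rw [h0]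
    by_cases h : (i : ℕ) < b
    · simp [lift, h, pos_firstRow]
    · simp only [lift, h, if_false, pos_firstRow, Fin.val_succ, add_lt_add_iff_left]
      omega
  · have := i.isLt
    split_ifs with h <;> simp only [lift, BPoint.pos] at h ⊢ <;> omega
  · have := j.isLt
    split_ifs with h <;> simp only [lift, BPoint.pos, Fin.val_succ] at h ⊢ <;> omega
  · have := j.isLt
    split_ifs with h <;> simp only [lift, BPoint.pos, Fin.val_succ] at h ⊢ <;> omega

lemma pos_lift_lt_iff (b : Fin (n + 1)) (p q : BPoint m n) :
    (lift b p).pos < (lift b q).pos ↔ p.pos < q.pos := by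
  rw [pos_lift, pos_lift]
  split_ifs <;> omega

lemma lift_injective (b : Fin (n + 1)) :
    Function.Injective (lift b : BPoint m n → BPoint (m + 1) n) := by
  intro p q h
  apply BPoint.pos_injective
  have h := congrArg BPoint.pos h
  rw [pos_lift, pos_lift] at h
  split_ifs at h <;> omega

/-- The cap inserts two positions, and the origin of ι moves by one as `m` grows; the position
shifts 0 and 2 thus become -1 and +1. -/
lemma iota_lift (b : Fin (n + 1)) (p : BPoint m n) (hp : ¬ p.IsBottom) :
    (lift b p).iota = if p.iota ≤ (b : ℤ) - n then p.iota - 1 else p.iota + 1 := by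
  have h1 := BPoint.pos_eq p hp
  have h2 := BPoint.pos_eq (lift b p) (by rwa [isBottom_lift])
  rw [pos_lift] at h2
  split_ifs at h2 ⊢ <;> push_cast at h2 <;> omega

lemma lift_ne_firstRow_castSucc (b : Fin (n + 1)) (p : BPoint m n) :
    lift b p ≠ firstRow b.castSucc := by
  intro h
  have h := congrArg BPoint.pos h
  rw [pos_lift, pos_firstRow, Fin.val_castSucc] at h
  split_ifs at h <;> omega

lemma lift_ne_firstRow_succ (b : Fin (n + 1)) (p : BPoint m n) :
    lift b p ≠ firstRow b.succ := by
  intro h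
  have h := congrArg BPoint.pos h
  rw [pos_lift, pos_firstRow, Fin.val_succ] at h
  split_ifs at h <;> omega

lemma eq_firstRow_or_eq_lift (b : Fin (n + 1)) (p : BPoint (m + 1) n) :
    p = firstRow b.castSucc ∨ p = firstRow b.succ ∨ ∃ q, p = lift b q := by
  have key : ∀ r : Fin (n + 2), (firstRow r : BPoint (m + 1) n) = firstRow b.castSucc ∨
      (firstRow r : BPoint (m + 1) n) = firstRow b.succ ∨
      ∃ q : BPoint m n, firstRow r = lift b q := by
    intro r
    rcases lt_trichotomy (r : ℕ) b with h | h | h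
    · refine .inr (.inr ⟨.top ⟨r, by omega⟩, ?_⟩)
      simp only [lift, h, if_true]; congr 1
    · left; congr 1; ext; simpa using h
    · by_cases h' : (r : ℕ) = b + 1
      · right; left; congr 1; ext; simpa using h'
      · refine .inr (.inr ⟨.top ⟨r - 2, by omega⟩, ?_⟩)
        have h2 : ¬ ((r : ℕ) - 2 < b) := by omega
        simp only [lift, h2, if_false]; congr 1; ext; simp; omega
  rcases p with i | i | j | j
  · have := key i.succ.castSucc
    have h : (firstRow i.succ.castSucc : BPoint (m + 1) n) = .top i := by
      simp [firstRow]
    rwa [h] at this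
  · exact .inr (.inr ⟨.bottom i, rfl⟩)
  · cases j using Fin.cases with
    | zero => exact key 0
    | succ j => exact .inr (.inr ⟨.left j, rfl⟩)
  · cases j using Fin.cases with
    | zero =>
      have := key (Fin.last _)
      have h : (firstRow (Fin.last (n + 1)) : BPoint (m + 1) n) = .right 0 := by
        simp [firstRow]
      rwa [h] at this
    | succ j => exact .inr (.inr ⟨.right j, rfl⟩)

/-! ### Contraction of the top row of a smoothed diagram -/

/-- The vertical segment on which the component of the `r`-th point of `firstRow` leaves a top row
with `b` positive markers, if any. -/
def slot (b : Fin (n + 1)) (r : ℕ) : Option (Segment m n) :=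
  if h : r < b then some (.ver 0 ⟨r, by omega⟩)
  else if r ≤ b + 1 then none
  else if h : r - 2 < n then some (.ver 0 ⟨r - 2, h⟩)
  else none

/-- The contraction of the top row of the smoothed diagram to the vertical segments below it. -/
def collapse (b : Fin (n + 1)) : Segment (m + 1) n → Option (Segment m n)
  | .hor j i => Fin.cases (slot b (if (i : ℕ) ≤ b then i else i + 1)) (fun j => some (.hor j i)) j
  | .ver j i => Fin.cases (slot b (i + 1)) (fun j => some (.ver j i)) j

/-- The segments of `L(m,n)` as those of `L(m+1,n)` below the top row. -/
def Segment.down : Segment m n → Segment (m + 1) n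
  | .hor j i => .hor j.succ i
  | .ver j i => .ver j.succ i

lemma collapse_segment_firstRow (b : Fin (n + 1)) (r : Fin (n + 2)) :
    collapse b (firstRow r : BPoint (m + 1) n).segment = slot b r := by
  unfold firstRow
  split_ifs with h h'
  · simp [BPoint.segment, collapse, h]
  · simp only [BPoint.segment, collapse, Fin.cases_zero]
    congr 1; omega
  · simp only [BPoint.segment, collapse, Fin.cases_zero, Fin.val_last]
    unfold slot
    have := b.isLt
    have := r.isLt
    have hr : r = Fin.last (n + 1) := by ext; simp; omega
    subst hr
    simp only [Fin.val_last]
    split_ifs <;> first | rfl | omega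

lemma collapse_segment_lift (b : Fin (n + 1)) (p : BPoint m n) :
    collapse b (lift b p).segment = some p.segment := by
  rcases p with i | i | j | j
  · simp only [lift]
    split_ifs with h
    · rw [collapse_segment_firstRow]
      simp [slot, h, BPoint.segment]
    · rw [collapse_segment_firstRow]
      have h1 : ¬ ((i : ℕ) + 1 + 1 < b) := by omega
      have h2 : ¬ ((i : ℕ) + 1 + 1 ≤ b + 1) := by omega
      simp [slot, h1, BPoint.segment, h]
  all_goals rfl

lemma collapse_segment_cap_left (b : Fin (n + 1)) :
    collapse b (firstRow b.castSucc : BPoint (m + 1) n).segment = none := by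
  simp [collapse_segment_firstRow, slot]

lemma collapse_segment_cap_right (b : Fin (n + 1)) :
    collapse b (firstRow b.succ : BPoint (m + 1) n).segment = none := by
  simp [collapse_segment_firstRow, slot]

lemma rowState_eq_plus {b : Fin m → Fin (n + 1)} {j : Fin m} {i : Fin n} :
    rowState b j i = .plus ↔ (i : ℕ) < b j := by
  simp [rowState]

lemma rowState_eq_minus {b : Fin m → Fin (n + 1)} {j : Fin m} {i : Fin n} :
    rowState b j i = .minus ↔ (b j : ℕ) ≤ i := by
  simp [rowState]

/-- The relation between two contracted segments that lie on the same component. -/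
def SameCollapse (s : KauffmanState m n) : Option (Segment m n) → Option (Segment m n) → Prop :=
  Option.Rel (SameComponent s)

lemma sameCollapse_equivalence (s : KauffmanState m n) : Equivalence (SameCollapse s) where
  refl x := by
    cases x
    · exact .none
    · exact .some (.refl _)
  symm h := by
    cases h with
    | none => exact .none
    | some h => exact .some (.symm _ _ h)
  trans h h' := by
    cases h with
    | none => exact h'
    | some h =>
      cases h' with
      | some h' => exact .some (.trans _ _ _ h h')

lemma sameCollapse_of_smoothing {b : Fin (m + 1) → Fin (n + 1)} {t u : Segment (m + 1) n}
    (h : Smoothing (rowState b) t u) :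
    SameCollapse (rowState (Fin.tail b)) (collapse (b 0) t) (collapse (b 0) u) := by
  have hrefl := (sameCollapse_equivalence (rowState (Fin.tail b))).refl
  have of_eq : ∀ {x y}, x = y → SameCollapse (rowState (Fin.tail b)) x y := by
    rintro x _ rfl; exact hrefl x
  cases h with
  | plus_above_right j i h =>
    cases j using Fin.cases with
    | zero =>
      rw [rowState_eq_plus] at h
      apply of_eq
      simp [collapse, Nat.succ_le_of_lt h]
    | succ j => exact .some (.rel _ _ (.plus_above_right j i h))
  | plus_left_below j i h =>
    cases j using Fin.cases with
    | zero =>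
      rw [rowState_eq_plus] at h
      apply of_eq
      simp only [collapse, Fin.cases_zero, Fin.val_castSucc, h.le, if_true, slot, h, dif_pos]
      rfl
    | succ j => exact .some (.rel _ _ (.plus_left_below j i h))
  | minus_above_left j i h =>
    cases j using Fin.cases with
    | zero =>
      rw [rowState_eq_minus] at h
      apply of_eq
      simp only [collapse, Fin.cases_zero, Fin.castSucc_zero, Fin.val_castSucc]
      split_ifs with h'
      · simp [slot, le_antisymm h' h]
      · rfl
    | succ j => exact .some (.rel _ _ (.minus_above_left j i h))
  | minus_right_below j i h =>
    cases j using Fin.cases with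
    | zero =>
      rw [rowState_eq_minus] at h
      apply of_eq
      have h1 : ¬ ((i : ℕ) + 1 ≤ b 0) := by omega
      have h2 : ¬ ((i : ℕ) + 1 + 1 < b 0) := by omega
      have h4 : (i : ℕ) + 1 + 1 - 2 = i := by omega
      simp only [collapse, Fin.cases_zero, Fin.cases_succ, Fin.val_succ, h1, if_false, slot, h2,
        dif_neg, not_false_eq_true, add_le_add_iff_right, h4, i.isLt, dif_pos]
    | succ j => exact .some (.rel _ _ (.minus_right_below j i h))

lemma sameComponent_down {b : Fin (m + 1) → Fin (n + 1)} {t u : Segment m n}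
    (h : SameComponent (rowState (Fin.tail b)) t u) :
    SameComponent (rowState b) t.down u.down := by
  induction h with
  | rel x y h =>
    refine .rel _ _ ?_
    cases h with
    | plus_above_right j i h => exact .plus_above_right j.succ i h
    | plus_left_below j i h => exact .plus_left_below j.succ i h
    | minus_above_left j i h => exact .minus_above_left j.succ i h
    | minus_right_below j i h => exact .minus_right_below j.succ i h
  | refl x => exact .refl _
  | symm x y _ ih => exact .symm _ _ ih
  | trans x y z _ _ ih ih' => exact .trans _ _ _ ih ih'

lemma sameComponent_hor_zero (b : Fin (m + 1) → Fin (n + 1)) (i : Fin (n + 1)) :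
    SameComponent (rowState b) (.hor 0 i)
      (((collapse (b 0) (.hor 0 i : Segment (m + 1) n)).map Segment.down).getD (.hor 0 (b 0))) := by
  have hi := i.isLt
  rcases lt_trichotomy (i : ℕ) (b 0) with h | h | h
  · have := Smoothing.plus_left_below (s := rowState b) 0 ⟨i, by omega⟩ (rowState_eq_plus.2 h)
    simpa [SameComponent, collapse, slot, h, h.le, Segment.down] using Relation.EqvGen.rel _ _ this
  · have h' : i = b 0 := Fin.ext h
    subst h'
    simpa [SameComponent, collapse, slot] using Relation.EqvGen.refl _
  · have := Smoothing.minus_right_below (s := rowState b) 0 ⟨i - 1, by omega⟩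
      (rowState_eq_minus.2 (by simp; omega))
    have h0 : (⟨i - 1, by omega⟩ : Fin n).succ = i := by ext; simp; omega
    rw [h0] at this
    have h1 : ¬ ((i : ℕ) ≤ b 0) := by omega
    have h2 : ¬ ((i : ℕ) + 1 < b 0) := by omega
    have h3 : (i : ℕ) + 1 - 2 = i - 1 := by omega
    have h4 : (i : ℕ) - 1 < n := by omega
    simpa [SameComponent, collapse, slot, h1, h2, h3, h4, Segment.down] using
      Relation.EqvGen.rel _ _ this

/-- Contraction stays within the component. The value `none` stands for the cap, whose
representative is the horizontal segment where the markers change sign. -/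
lemma sameComponent_collapse (b : Fin (m + 1) → Fin (n + 1)) (t : Segment (m + 1) n) :
    SameComponent (rowState b) t
      (((collapse (b 0) t).map Segment.down).getD (.hor 0 (b 0))) := by
  rcases t with ⟨j, i⟩ | ⟨j, i⟩ <;> cases j using Fin.cases with
    | succ j => exact .refl _
    | zero => ?_
  · exact sameComponent_hor_zero b i
  · have key : ∀ k, Smoothing (rowState b) (.ver 0 i) (.hor 0 k) →
        collapse (b 0) (.ver 0 i : Segment (m + 1) n) = collapse (b 0) (.hor 0 k) →
        SameComponent (rowState b) (.ver 0 i)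
          (((collapse (b 0) (.ver 0 i)).map Segment.down).getD (.hor 0 (b 0))) := by
      intro k hk e
      rw [e]
      exact .trans _ _ _ (.rel _ _ hk) (sameComponent_hor_zero b k)
    by_cases h : (i : ℕ) < b 0
    · refine key i.succ (.plus_above_right 0 i (rowState_eq_plus.2 h)) ?_
      simp [collapse, Nat.succ_le_of_lt h]
    · refine key i.castSucc (.minus_above_left 0 i (rowState_eq_minus.2 (by omega))) ?_
      simp only [collapse, Fin.cases_zero, Fin.val_castSucc]
      split_ifs with h'
      · simp [slot, show (i : ℕ) = b 0 by omega]
      · rfl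

/-- Forwards, smoothings in the top row join segments with equal contraction, and lower ones are
smoothings of the smaller diagram. Backwards, both segments are connected to the representatives of
their contractions. -/
lemma sameComponent_iff (b : Fin (m + 1) → Fin (n + 1)) (t u : Segment (m + 1) n) :
    SameComponent (rowState b) t u ↔
      SameCollapse (rowState (Fin.tail b)) (collapse (b 0) t) (collapse (b 0) u) := by
  constructor
  · intro h
    have e := sameCollapse_equivalence (rowState (Fin.tail b))
    induction h with
    | rel x y h => exact sameCollapse_of_smoothing h
    | refl x => exact e.refl _
    | symm x y _ ih => exact e.symm ih
    | trans x y z _ _ ih ih' => exact e.trans ih ih'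
  · intro h
    refine .trans _ _ _ (sameComponent_collapse b t)
      (.trans _ _ _ ?_ (.symm _ _ (sameComponent_collapse b u)))
    generalize collapse (b 0) t = x at *
    generalize collapse (b 0) u = y at *
    cases h with
    | none => exact .refl _
    | some h => exact sameComponent_down h

/-! ### Peeling a cap off a Catalan state -/

namespace CatalanState

lemma mate_injective (C : CatalanState m n) : Function.Injective C.mate :=
  Function.LeftInverse.injective C.mate_mate

/-- Noncrossing in the form used below: an arc that starts under another arc also ends under it. -/
lemma pos_mate_mem (C : CatalanState m n) {p x : BPoint m n} (h1 : p.pos < x.pos)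
    (h2 : x.pos < (C.mate p).pos) :
    p.pos < (C.mate x).pos ∧ (C.mate x).pos < (C.mate p).pos := by
  have a := C.noncrossing p x
  have b := C.noncrossing (C.mate x) p
  rw [C.mate_mate] at b
  have c : (C.mate x).pos ≠ (C.mate p).pos := fun h => by
    have := C.mate_injective (BPoint.pos_injective h)
    subst this; omega
  have d : (C.mate x).pos ≠ p.pos := fun h => by
    have := BPoint.pos_injective h
    subst this
    rw [C.mate_mate] at h2; omega
  omega

/-- `C'` is what remains of `C` below a top row that realizes the arc joining the `b`-th and the
`(b+1)`-st point of `firstRow`. -/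
structure IsPeeling (C : CatalanState (m + 1) n) (b : Fin (n + 1)) (C' : CatalanState m n) :
    Prop where
  cap : C.mate (firstRow b.castSucc) = firstRow b.succ
  lift_mate : ∀ p, lift b (C'.mate p) = C.mate (lift b p)

lemma exists_isPeeling (C : CatalanState (m + 1) n) (b : Fin (n + 1))
    (h : C.mate (firstRow b.castSucc) = firstRow b.succ) : ∃ C', C.IsPeeling b C' := by
  have key : ∀ p : BPoint m n, ∃ q : BPoint m n, lift b q = C.mate (lift b p) := by
    intro p
    rcases eq_firstRow_or_eq_lift b (C.mate (lift b p)) with e | e | ⟨q, e⟩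
    · rw [← C.mate_mate (firstRow b.castSucc), h] at e
      exact absurd (C.mate_injective e) (lift_ne_firstRow_succ b p)
    · rw [← h] at e
      exact absurd (C.mate_injective e) (lift_ne_firstRow_castSucc b p)
    · exact ⟨q, e.symm⟩
  choose f hf using key
  exact ⟨{
    mate := f
    mate_mate := fun p => lift_injective b (by rw [hf, hf, C.mate_mate])
    mate_ne := fun p e => C.mate_ne (lift b p) (by rw [← hf, e])
    noncrossing := fun p q e => C.noncrossing (lift b p) (lift b q)
      (by simpa only [← hf, pos_lift_lt_iff] using e) }, h, hf⟩

namespace IsPeeling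

variable {C : CatalanState (m + 1) n} {b : Fin (n + 1)} {C' : CatalanState m n}

lemma cap_symm (h : C.IsPeeling b C') : C.mate (firstRow b.succ) = firstRow b.castSucc := by
  rw [← h.cap, C.mate_mate]

lemma noBottomReturns (h : C.IsPeeling b C') (hC : C.NoBottomReturns) : C'.NoBottomReturns := by
  intro p hp
  rw [← isBottom_lift b, h.lift_mate]
  exact hC _ ((isBottom_lift b p).2 hp)

end IsPeeling

end CatalanState

lemma realizes_iff_of_isPeeling {C : CatalanState (m + 1) n} {C' : CatalanState m n}
    {b : Fin (m + 1) → Fin (n + 1)} (h : C.IsPeeling (b 0) C') :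
    (rowState b).Realizes C ↔ (rowState (Fin.tail b)).Realizes C' := by
  have hne : (firstRow (b 0).castSucc : BPoint (m + 1) n) ≠ firstRow (b 0).succ :=
    fun e => (Fin.castSucc_lt_succ (i := b 0)).ne (firstRow_injective e)
  constructor
  · intro hC p q
    have := hC (lift (b 0) p) (lift (b 0) q)
    rwa [← h.lift_mate, (lift_injective _).eq_iff, (lift_injective _).ne_iff, sameComponent_iff,
      collapse_segment_lift, collapse_segment_lift, SameCollapse, Option.rel_some_some] at this
  · intro hC p q
    rw [sameComponent_iff]
    -- Only the case of two lifted points involves `C'`; in the others at least one point is an end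
    -- of the cap, and both sides are decided outright.
    rcases eq_firstRow_or_eq_lift (b 0) p with rfl | rfl | ⟨p, rfl⟩ <;>
      rcases eq_firstRow_or_eq_lift (b 0) q with rfl | rfl | ⟨q, rfl⟩ <;>
      simp only [h.cap, h.cap_symm, ← h.lift_mate, collapse_segment_lift, collapse_segment_cap_left,
        collapse_segment_cap_right, SameCollapse, Option.rel_some_some, Option.rel_none_none,
        Option.not_rel_some_none, Option.not_rel_none_some, (lift_injective _).eq_iff,
        (lift_injective _).ne_iff, lift_ne_firstRow_castSucc, lift_ne_firstRow_succ, hne, hne.symm,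
        (lift_ne_firstRow_castSucc _ _).symm, (lift_ne_firstRow_succ _ _).symm, ne_eq, and_false,
        and_true, not_true_eq_false, not_false_eq_true]
    exact hC p q

lemma exists_isPeeling_of_realizes {C : CatalanState (m + 1) n}
    {b : Fin (m + 1) → Fin (n + 1)} (h : (rowState b).Realizes C) :
    ∃ C', C.IsPeeling (b 0) C' := by
  apply C.exists_isPeeling
  rw [h, sameComponent_iff, collapse_segment_cap_left, collapse_segment_cap_right]
  exact ⟨fun e => (Fin.castSucc_lt_succ (i := b 0)).ne (firstRow_injective e), .none⟩

/-! ### Horizontal cuts of realizable states -/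

/-- The point lies above the horizontal line that separates the first `j` rows from the others. -/
def BPoint.Above (j : ℕ) : BPoint m n → Prop
  | .top _ => True
  | .bottom _ => False
  | .left i => (i : ℕ) < j
  | .right i => (i : ℕ) < j

lemma above_lift (b : Fin (n + 1)) (j : ℕ) (p : BPoint m n) :
    (lift b p).Above (j + 1) ↔ p.Above j := by
  have key : ∀ r, (firstRow r : BPoint (m + 1) n).Above (j + 1) := by
    intro r
    unfold firstRow
    split_ifs <;> simp [BPoint.Above]
  rcases p with i | i | i | i
  · simp only [lift]
    split_ifs <;> simp only [key] <;> simp [BPoint.Above]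
  all_goals simp [lift, BPoint.Above]

lemma above_one_iff (p : BPoint (m + 1) n) : p.Above 1 ↔ ∃ r, p = firstRow r := by
  constructor
  · intro h
    rcases p with i | i | i | i
    · exact ⟨i.succ.castSucc, by simp [firstRow]⟩
    · exact h.elim
    · have h : (i : ℕ) < 1 := h
      obtain rfl : i = 0 := Fin.ext (by rw [Fin.val_zero]; omega)
      exact ⟨0, by simp [firstRow]⟩
    · have h : (i : ℕ) < 1 := h
      obtain rfl : i = 0 := Fin.ext (by rw [Fin.val_zero]; omega)
      exact ⟨Fin.last _, by simp [firstRow]⟩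
  · rintro ⟨r, rfl⟩
    unfold firstRow
    split_ifs <;> simp [BPoint.Above]

namespace CatalanState

/-- Every horizontal line between two rows meets at most `n` arcs that it has to meet. -/
def CutBound (C : CatalanState m n) : Prop :=
  ∀ j ≤ m, Set.ncard {p : BPoint m n | p.Above j ∧ ¬ (C.mate p).Above j} ≤ n

lemma IsPeeling.cutBound {C : CatalanState (m + 1) n} {b : Fin (n + 1)} {C' : CatalanState m n}
    (h : C.IsPeeling b C') (hC : C.CutBound) : C'.CutBound := by
  intro j hj
  refine le_trans ?_ (hC (j + 1) (by omega))
  refine Set.ncard_le_ncard_of_injOn (lift b) ?_ (lift_injective b).injOn (Set.toFinite _)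
  intro p hp
  simpa only [Set.mem_ofPred_eq, ← h.lift_mate, above_lift] using hp

end CatalanState

/-- The segment lies above the horizontal line that separates the first `j` rows from the
others. -/
def Segment.Above (j : ℕ) : Segment m n → Prop
  | .hor i _ => (i : ℕ) < j
  | .ver i _ => (i : ℕ) < j

/-- A path of smoothings can change sides of the line only at a vertical segment `ver j i`; these
segments count as below the line. -/
lemma exists_ver_of_sameComponent (s : KauffmanState m n) (j : Fin (m + 1)) {t u : Segment m n}
    (h : SameComponent s t u) :
    (t.Above j ↔ u.Above j) ∨ ∃ i, SameComponent s t (.ver j i) := by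
  induction h with
  | rel x y h =>
    have rel := Relation.EqvGen.rel _ _ h
    cases h with
    | plus_above_right k i h =>
      by_cases e : k.castSucc = j
      · exact .inr ⟨i, e ▸ .refl _⟩
      · exact .inl (by simp [Segment.Above])
    | plus_left_below k i h =>
      by_cases e : k.succ = j
      · exact .inr ⟨i, e ▸ rel⟩
      · have e : (k : ℕ) + 1 ≠ j := fun e' => e (Fin.ext (by simpa using e'))
        exact .inl (by simp [Segment.Above]; omega)
    | minus_above_left k i h =>
      by_cases e : k.castSucc = j
      · exact .inr ⟨i, e ▸ .refl _⟩
      · exact .inl (by simp [Segment.Above])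
    | minus_right_below k i h =>
      by_cases e : k.succ = j
      · exact .inr ⟨i, e ▸ rel⟩
      · have e : (k : ℕ) + 1 ≠ j := fun e' => e (Fin.ext (by simpa using e'))
        exact .inl (by simp [Segment.Above]; omega)
  | refl x => exact .inl Iff.rfl
  | symm x y h ih =>
    rcases ih with ih | ⟨i, ih⟩
    · exact .inl ih.symm
    · exact .inr ⟨i, .trans _ _ _ (.symm _ _ h) ih⟩
  | trans x y z h h' ih ih' =>
    rcases ih with ih | ⟨i, ih⟩
    · rcases ih' with ih' | ⟨i, ih'⟩
      · exact .inl (ih.trans ih')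
      · exact .inr ⟨i, .trans _ _ _ h ih'⟩
    · exact .inr ⟨i, ih⟩

lemma exists_ver_of_above (s : KauffmanState m n) (j : Fin (m + 1)) {p q : BPoint m n}
    (h : SameComponent s p.segment q.segment) (hp : p.Above j) (hq : ¬ q.Above j) :
    ∃ i, SameComponent s p.segment (.ver j i) := by
  -- For `j = 0` the top points are above the line although their segments are not; this is the
  -- exception excluded on the right.
  have key : ∀ r : BPoint m n, r.segment.Above j ↔ r.Above j ∧ ∀ i, r.segment ≠ .ver j i := by
    intro r
    have hj := j.isLt
    rcases r with i | i | i | i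
    · refine ⟨fun h => ⟨trivial, fun i' e => ?_⟩, fun h => ?_⟩
      · obtain ⟨rfl, -⟩ := Segment.ver.inj e
        exact lt_irrefl _ h
      · refine Nat.pos_of_ne_zero fun e => ?_
        obtain rfl : j = 0 := Fin.ext e
        exact h.2 i rfl
    · simp [BPoint.segment, BPoint.Above, Segment.Above]; omega
    · simp [BPoint.segment, BPoint.Above, Segment.Above]
    · simp [BPoint.segment, BPoint.Above, Segment.Above]
  rcases exists_ver_of_sameComponent s j h with e | e
  · rw [key, key] at e
    by_cases hv : ∃ i, p.segment = .ver j i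
    · obtain ⟨i, hv⟩ := hv
      exact ⟨i, hv ▸ .refl _⟩
    · push Not at hv
      exact absurd (e.1 ⟨hp, hv⟩).1 hq
  · exact e

lemma CatalanState.Realizable.cutBound {C : CatalanState m n} (h : C.Realizable) :
    C.CutBound := by
  obtain ⟨s, hs⟩ := h
  intro j hj
  have key : ∀ p : {p : BPoint m n | p.Above j ∧ ¬ (C.mate p).Above j},
      ∃ i : Fin n, SameComponent s p.1.segment (.ver ⟨j, by omega⟩ i) := fun p =>
    exists_ver_of_above s ⟨j, by omega⟩ ((hs p _).1 rfl).2 p.2.1 p.2.2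
  choose f hf using key
  have hinj : Function.Injective f := by
    intro p q e
    by_contra hpq
    -- Two points sent to the same vertical segment would be mates, but both lie above the line and
    -- their mates do not.
    have := (hs p q).2 ⟨fun e => hpq (Subtype.ext e),
      .trans _ _ _ (hf p) (e ▸ .symm _ _ (hf q))⟩
    exact p.2.2 (this ▸ q.2.1)
  simpa using Nat.card_le_card_of_injective f hinj

/-! ### The rightmost cap -/

namespace CatalanState

lemma mem_upperArcs {C : CatalanState m n} {p q : BPoint m n} :
    (p, q) ∈ C.upperArcs ↔
      C.mate p = q ∧ ¬ p.IsBottom ∧ ¬ q.IsBottom ∧ p.iota < q.iota := by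
  simp [upperArcs]

/-- The `b`-th and the `(b+1)`-st point of `firstRow` are joined by an arc, and this is the
rightmost arc between two points of `firstRow`. -/
structure IsRightmostCap (C : CatalanState (m + 1) n) (b : Fin (n + 1)) : Prop where
  cap : C.mate (firstRow b.castSucc) = firstRow b.succ
  le : ∀ r r', r < r' → C.mate (firstRow r) = firstRow r' → r ≤ b.castSucc

/-- If no arc joined two points of `firstRow`, all `n + 2` of them would be ends of arcs crossing
the first cut. Among the arcs that do, the one with the rightmost left end has adjacent ends. -/
lemma CutBound.exists_isRightmostCap {C : CatalanState (m + 1) n} (hC : C.CutBound) :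
    ∃ b, C.IsRightmostCap b := by
  set A : Set (Fin (n + 2)) := {r | ∃ r', r < r' ∧ C.mate (firstRow r) = firstRow r'} with hA
  have hne : A.Nonempty := by
    by_contra hempty
    have h1 := hC 1 (by omega)
    have h2 : Set.range (firstRow : Fin (n + 2) → BPoint (m + 1) n) ⊆
        {p | p.Above 1 ∧ ¬ (C.mate p).Above 1} := by
      rintro _ ⟨r, rfl⟩
      refine ⟨(above_one_iff _).2 ⟨r, rfl⟩, fun h => hempty ?_⟩
      obtain ⟨r', h⟩ := (above_one_iff _).1 h
      rcases lt_trichotomy r r' with hr | rfl | hr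
      · exact ⟨r, r', hr, h⟩
      · exact absurd h (C.mate_ne _)
      · exact ⟨r', r, hr, by rw [← h, C.mate_mate]⟩
    have h3 := Set.ncard_le_ncard h2 (Set.toFinite _)
    rw [← Set.image_univ, Set.ncard_image_of_injective _ firstRow_injective, Set.ncard_univ,
      Nat.card_eq_fintype_card, Fintype.card_fin] at h3
    omega
  obtain ⟨r, ⟨r', hr, h⟩, hmax⟩ := Set.exists_max_image A id (Set.toFinite A) hne
  -- Otherwise the point `r + 1` lies under the arc, so its mate lies further right under it, giving
  -- an arc with left end beyond the maximal `r`.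
  have hr' : (r' : ℕ) = r + 1 := by
    by_contra hlt
    have hlt' : (r : ℕ) + 1 < r' := by have : (r : ℕ) < r' := hr; omega
    set x : Fin (n + 2) := ⟨r + 1, by omega⟩ with hx
    have hmem := C.pos_mate_mem (p := firstRow r) (x := firstRow x)
      (by simp [pos_firstRow, hx]) (by rw [h]; simp [pos_firstRow, hx, hlt'])
    rw [h, pos_firstRow, pos_firstRow] at hmem
    have he : C.mate (firstRow x) =
        firstRow ⟨(C.mate (firstRow x)).pos - m, by omega⟩ := by
      apply BPoint.pos_injective
      rw [pos_firstRow]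
      simp only
      omega
    have hne := C.mate_ne (firstRow x)
    have hxpos : (C.mate (firstRow x)).pos ≠ (firstRow x : BPoint (m + 1) n).pos :=
      fun e => hne (BPoint.pos_injective e)
    rw [pos_firstRow] at hxpos
    have hle := hmax x ⟨_, ?_, he⟩
    · have hle : (x : ℕ) ≤ r := hle
      simp [hx] at hle
    · rw [Fin.lt_def]
      simp only [hx] at hxpos hmem ⊢
      omega
  have hrn : (r : ℕ) < n + 1 := by omega
  have e : (⟨r, hrn⟩ : Fin (n + 1)).succ = r' := Fin.ext hr'.symm
  exact ⟨⟨r, hrn⟩, by rw [e]; exact h, fun t t' ht e => hmax t ⟨t', ht, e⟩⟩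

/-! ### Upper arcs and the claimed value under peeling -/

namespace IsPeeling

variable {C : CatalanState (m + 1) n} {b : Fin (n + 1)} {C' : CatalanState m n}

lemma iota_lift_lt_iff (b : Fin (n + 1)) {p q : BPoint m n} (hp : ¬ p.IsBottom)
    (hq : ¬ q.IsBottom) : (lift b p).iota < (lift b q).iota ↔ p.iota < q.iota := by
  rw [iota_lift b p hp, iota_lift b q hq]
  split_ifs <;> omega

lemma upperArcs_eq (h : C.IsPeeling b C') :
    C.upperArcs = insert (firstRow b.castSucc, firstRow b.succ)
      (C'.upperArcs.image (Prod.map (lift b) (lift b))) := by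
  have hiota : (firstRow b.castSucc : BPoint (m + 1) n).iota <
      (firstRow b.succ : BPoint (m + 1) n).iota := by
    rw [iota_firstRow, iota_firstRow]; simp
  have hne : (firstRow b.castSucc : BPoint (m + 1) n) ≠ firstRow b.succ :=
    fun e => hiota.ne (congrArg _ e)
  ext ⟨p, q⟩
  simp only [Finset.mem_insert, Finset.mem_image, Prod.exists, Prod.map_apply, Prod.mk.injEq,
    mem_upperArcs]
  constructor
  · rintro ⟨rfl, hp, hq, hlt⟩
    rcases eq_firstRow_or_eq_lift b p with rfl | rfl | ⟨p, rfl⟩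
    · exact .inl ⟨rfl, h.cap⟩
    · rw [h.cap_symm] at hlt
      exact absurd hlt hiota.not_gt
    · rw [← h.lift_mate, isBottom_lift] at hq
      rw [isBottom_lift] at hp
      rw [← h.lift_mate, iota_lift_lt_iff b hp hq] at hlt
      exact .inr ⟨p, _, ⟨rfl, hp, hq, hlt⟩, rfl, h.lift_mate p⟩
  · rintro (⟨rfl, rfl⟩ | ⟨p, q, ⟨rfl, hp, hq, hlt⟩, rfl, rfl⟩)
    · exact ⟨h.cap, not_isBottom_firstRow _, not_isBottom_firstRow _, hiota⟩
    · exact ⟨(h.lift_mate p).symm, by rwa [isBottom_lift], by rwa [isBottom_lift],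
        (iota_lift_lt_iff b hp hq).2 hlt⟩

lemma sum_upperArcs (h : C.IsPeeling b C') (g : BPoint (m + 1) n × BPoint (m + 1) n → ℤ) :
    ∑ a ∈ C.upperArcs, g a = g (firstRow b.castSucc, firstRow b.succ) +
      ∑ a ∈ C'.upperArcs, g (lift b a.1, lift b a.2) := by
  rw [h.upperArcs_eq, Finset.sum_insert, Finset.sum_image]
  · rfl
  · exact ((lift_injective b).prodMap (lift_injective b)).injOn
  · simp only [Finset.mem_image, Prod.exists, Prod.map_apply, Prod.mk.injEq, not_exists, not_and]
    intro p q _ e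
    exact absurd e (lift_ne_firstRow_castSucc b p)

lemma card_upperArcs (h : C.IsPeeling b C') : C.upperArcs.card = C'.upperArcs.card + 1 := by
  have := h.sum_upperArcs fun _ => 1
  simp only [Finset.sum_const, nsmul_eq_mul, mul_one] at this
  omega

end IsPeeling

/-- The value claimed for `β(C)`. -/
def betaValue (C : CatalanState m n) : ℤ :=
  (m : ℤ) * n + (m : ℤ) * ((m : ℤ) - 1) / 2 + ∑ a ∈ C.upperArcs, min a.1.iota (1 - a.2.iota)

namespace IsPeeling

variable {C : CatalanState (m + 1) n} {b : Fin (n + 1)} {C' : CatalanState m n}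

/-- The product term grows by `n` and the cap contributes `b - n`, which together make `b`. The
triangular term grows by `m`, which is spread as 1 over each of the `m` remaining arcs. -/
lemma betaValue_sub (h : C.IsPeeling b C') (hcard : C'.upperArcs.card = m) :
    C.betaValue - (C'.betaValue + b) = ∑ a ∈ C'.upperArcs,
      (min (lift b a.1).iota (1 - (lift b a.2).iota) - (min a.1.iota (1 - a.2.iota) - 1)) := by
  have hb := b.isLt
  have hdiv : ((m + 1 : ℕ) : ℤ) * (((m + 1 : ℕ) : ℤ) - 1) / 2 = (m : ℤ) * (m - 1) / 2 + m := by
    rw [← Int.add_mul_ediv_right _ _ two_ne_zero]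
    congr 1; push_cast; ring
  have hcap : min ((b : ℤ) - n) (1 - ((b + 1 : ℕ) - n : ℤ)) = b - n := by
    apply min_eq_left; push_cast; omega
  unfold betaValue
  rw [h.sum_upperArcs, hdiv, Finset.sum_sub_distrib, Finset.sum_sub_distrib, Finset.sum_const,
    hcard]
  simp only [iota_firstRow, Fin.val_castSucc, Fin.val_succ, hcap]
  push_cast
  simp
  ring

lemma min_iota_lift (b : Fin (n + 1)) {C' : CatalanState m n} {p q : BPoint m n}
    (ha : (p, q) ∈ C'.upperArcs) :
    min p.iota (1 - q.iota) - 1 ≤ min (lift b p).iota (1 - (lift b q).iota) := by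
  obtain ⟨-, hp, hq, hlt⟩ := mem_upperArcs.1 ha
  have := b.isLt
  rw [iota_lift b p hp, iota_lift b q hq]
  split_ifs <;> omega

lemma betaValue_le (h : C.IsPeeling b C') (hcard : C'.upperArcs.card = m) :
    C'.betaValue + b ≤ C.betaValue := by
  rw [← sub_nonneg, h.betaValue_sub hcard]
  exact Finset.sum_nonneg fun a ha => sub_nonneg.2 (min_iota_lift b ha)

end IsPeeling

/-! ### Equality for the rightmost cap -/

/-- All points of the first row under an arc to the right of the rightmost cap are joined to points
beyond the first row that lie under the same arc. -/
lemma IsRightmostCap.three_le_iota_add {C : CatalanState (m + 1) n} {b : Fin (n + 1)}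
    (h : C.IsRightmostCap b) {p q : BPoint (m + 1) n} (ha : (p, q) ∈ C.upperArcs)
    (hp : (b : ℤ) - n < p.iota) : 3 ≤ p.iota + q.iota := by
  obtain ⟨hmate, hpb, hqb, hlt⟩ := mem_upperArcs.1 ha
  have hppos := BPoint.pos_eq p hpb
  have hqpos := BPoint.pos_eq q hqb
  push_cast at hppos hqpos
  have hb := b.isLt
  have eq_firstRow : ∀ x : BPoint (m + 1) n, ¬ x.IsBottom → (b : ℤ) - n < x.iota →
      x.iota ≤ 1 → ∃ r : Fin (n + 2), b.castSucc < r ∧ x = firstRow r := by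
    intro x hx h1 h2
    have hxpos := BPoint.pos_eq x hx
    push_cast at hxpos
    refine ⟨⟨x.pos - m, by omega⟩, ?_, BPoint.pos_injective ?_⟩
    · rw [Fin.lt_def]; simp only [Fin.val_castSucc]; omega
    · rw [pos_firstRow]; simp only; omega
  have no_arc : ∀ x : BPoint (m + 1) n, ¬ x.IsBottom → ¬ (C.mate x).IsBottom →
      (b : ℤ) - n < x.iota → x.iota ≤ 1 → (b : ℤ) - n < (C.mate x).iota →
      2 ≤ (C.mate x).iota := by
    intro x hx hx' h1 h2 h3
    by_contra h4
    obtain ⟨r, hr, e⟩ := eq_firstRow x hx h1 h2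
    obtain ⟨r', hr', e'⟩ := eq_firstRow _ hx' h3 (by omega)
    rcases lt_trichotomy r r' with hlt | rfl | hlt
    · exact absurd (h.le r r' hlt (by rw [← e, e'])) hr.not_ge
    · exact C.mate_ne x (e'.trans e.symm)
    · exact absurd (h.le r' r hlt (by rw [← e, ← e', C.mate_mate])) hr'.not_ge
  have hq : 2 ≤ q.iota := by
    by_cases hp1 : p.iota ≤ 1
    · rw [← hmate] at hqb hlt ⊢
      exact no_arc p hpb hqb hp hp1 (by omega)
    · omega
  -- The points of `firstRow` have ι from `-n` to 1, so these `k` are exactly the coordinates of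
  -- those to the right of `p`.
  have inner : ∀ k ∈ Finset.Ioc p.iota 1, ∃ x : BPoint (m + 1) n, x.iota = k ∧ ¬ x.IsBottom ∧
      ¬ (C.mate x).IsBottom ∧ 2 ≤ (C.mate x).iota ∧ (C.mate x).iota < q.iota := by
    intro k hk
    rw [Finset.mem_Ioc] at hk
    set r : Fin (n + 2) := ⟨(k + n).toNat, by omega⟩ with hr
    have hk' : (firstRow r : BPoint (m + 1) n).iota = k := by
      rw [iota_firstRow]; simp only [hr]; omega
    have hrb : ¬ (firstRow r : BPoint (m + 1) n).IsBottom := not_isBottom_firstRow r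
    have hrpos := BPoint.pos_eq _ hrb
    push_cast at hrpos
    have hmem := C.pos_mate_mem (p := p) (x := firstRow r) (by omega) (by rw [hmate]; omega)
    rw [hmate] at hmem
    have hmb : ¬ (C.mate (firstRow r)).IsBottom := fun e =>
      absurd (BPoint.pos_lt_of_isBottom hqb e) (by omega)
    have hmpos := BPoint.pos_eq _ hmb
    push_cast at hmpos
    exact ⟨_, hk', hrb, hmb, no_arc _ hrb hmb (by omega) (by omega) (by omega), by omega⟩
  have : Nonempty (BPoint (m + 1) n) := ⟨p⟩
  choose! f hf using inner
  -- Matching is injective, so there are at least as many coordinates from 2 up to `q` (excluded) as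
  -- points of the first row beyond `p`; this yields the bound 3.
  have hcard : (Finset.Ioc p.iota 1).card ≤ (Finset.Ico 2 q.iota).card := by
    refine Finset.card_le_card_of_injOn (fun k => (C.mate (f k)).iota) ?_ ?_
    · intro k hk
      obtain ⟨-, -, -, h1, h2⟩ := hf k hk
      simpa using ⟨h1, h2⟩
    · intro k hk l hl e
      obtain ⟨h1, -, h2, -⟩ := hf k hk
      obtain ⟨h1', -, h2', -⟩ := hf l hl
      have e : (C.mate (f k)).iota = (C.mate (f l)).iota := e
      have e1 := BPoint.pos_eq _ h2
      have e2 := BPoint.pos_eq _ h2'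
      have := C.mate_injective (BPoint.pos_injective 
        (by omega : (C.mate (f k)).pos = (C.mate (f l)).pos))
      rw [← h1, ← h1', this]
  rw [Int.card_Ioc, Int.card_Ico] at hcard
  omega

/-- A summand of `betaValue_sub` can be positive only when both ends lie on the same side of the
cap. To the left, both coordinates are at most 0 and the minimum is ι of the left end; to the right,
`three_le_iota_add` makes the other entry the minimum. -/
lemma IsRightmostCap.betaValue_eq {C : CatalanState (m + 1) n} {b : Fin (n + 1)}
    {C' : CatalanState m n} (hb : C.IsRightmostCap b) (h : C.IsPeeling b C')
    (hcard : C'.upperArcs.card = m) : C.betaValue = C'.betaValue + b := by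
  rw [← sub_eq_zero, h.betaValue_sub hcard]
  refine Finset.sum_eq_zero fun ⟨p, q⟩ ha => ?_
  have hmem : (lift b p, lift b q) ∈ C.upperArcs := by
    rw [h.upperArcs_eq]
    exact Finset.mem_insert_of_mem (Finset.mem_image_of_mem (Prod.map (lift b) (lift b)) ha)
  have h3 := hb.three_le_iota_add hmem
  obtain ⟨-, hp, hq, hlt⟩ := mem_upperArcs.1 ha
  have := b.isLt
  simp only [iota_lift b p hp, iota_lift b q hq] at h3 ⊢
  split_ifs at h3 ⊢ <;> omega

/-! ### The diagram without rows -/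

lemma sameComponent_iff_eq {s : KauffmanState 0 n} {t u : Segment 0 n} :
    SameComponent s t u ↔ t = u := by
  constructor
  · intro h
    induction h with
    | rel x y h => cases h with
      | plus_above_right j | plus_left_below j | minus_above_left j | minus_right_below j =>
        exact j.elim0
    | refl x => rfl
    | symm x y _ ih => exact ih.symm
    | trans x y z _ _ ih ih' => exact ih.trans ih'
  · rintro rfl
    exact .refl _

/-- Bottom points are matched with top points in increasing order, as arcs do not cross, and the
only strictly monotone self-map of `Fin n` is the identity. -/
lemma NoBottomReturns.mate_bottom {C : CatalanState 0 n} (h : C.NoBottomReturns) (i : Fin n) :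
    C.mate (.bottom i) = .top i := by
  have key : ∀ i, ∃ k, C.mate (.bottom i) = .top k := by
    intro i
    have := h (.bottom i) trivial
    generalize C.mate (.bottom i) = p at this ⊢
    rcases p with k | k | k | k
    · exact ⟨k, rfl⟩
    · exact absurd trivial this
    · exact k.elim0
    · exact k.elim0
  choose f hf using key
  have hinj : Function.Injective f := fun i k e => by
    have := C.mate_injective ((hf i).trans (e ▸ (hf k).symm))
    simpa using this
  have hmono : StrictMono f := by
    intro i k hik
    refine lt_of_le_of_ne (not_lt.1 fun hlt => ?_) (hinj.ne hik.ne)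
    -- Positions run backwards along the bottom side, so an inversion of `f` is a crossing.
    refine C.noncrossing (.top (f k)) (.top (f i)) ?_
    rw [← hf, ← hf, C.mate_mate, C.mate_mate, hf, hf]
    simp only [BPoint.pos]
    have : (f k : ℕ) < f i := hlt
    have : (i : ℕ) < k := hik
    omega
  have hid : f = id := hmono.eq_id
  rw [hf, hid, id]

lemma NoBottomReturns.mate_top {C : CatalanState 0 n} (h : C.NoBottomReturns) (i : Fin n) :
    C.mate (.top i) = .bottom i := by
  rw [← h.mate_bottom, C.mate_mate]

lemma NoBottomReturns.upperArcs_eq_empty {C : CatalanState 0 n} (h : C.NoBottomReturns) :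
    C.upperArcs = ∅ := by
  rw [Finset.eq_empty_iff_forall_notMem]
  rintro ⟨p, q⟩ ha
  obtain ⟨rfl, hp, hq, -⟩ := mem_upperArcs.1 ha
  rcases p with i | i | i | i
  · rw [h.mate_top] at hq
    exact hq trivial
  · exact hp trivial
  · exact i.elim0
  · exact i.elim0

lemma NoBottomReturns.realizes {C : CatalanState 0 n} (h : C.NoBottomReturns)
    (s : KauffmanState 0 n) : s.Realizes C := by
  intro p q
  rw [sameComponent_iff_eq]
  rcases p with i | i | i | i <;> rcases q with k | k | k | k <;>
    first | exact i.elim0 | exact k.elim0 | simp [h.mate_top, h.mate_bottom, BPoint.segment]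

lemma NoBottomReturns.betaValue_eq_zero {C : CatalanState 0 n} (h : C.NoBottomReturns) :
    C.betaValue = 0 := by
  simp [betaValue, h.upperArcs_eq_empty]

/-! ### Upper bound and attainment -/

/-- The count is proved along with the bound because `betaValue_le` needs it at each step; every
peeling removes exactly one upper arc. -/
lemma card_upperArcs_and_sum_le {C : CatalanState m n} (hC : C.NoBottomReturns)
    {b : Fin m → Fin (n + 1)} (hb : (rowState b).Realizes C) :
    C.upperArcs.card = m ∧ ((∑ j, (b j : ℕ) : ℕ) : ℤ) ≤ C.betaValue := by
  induction m with
  | zero => simp [hC.upperArcs_eq_empty, hC.betaValue_eq_zero]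
  | succ m ih =>
    obtain ⟨C', h⟩ := exists_isPeeling_of_realizes hb
    obtain ⟨hcard, hle⟩ := ih (h.noBottomReturns hC) ((realizes_iff_of_isPeeling h).1 hb)
    refine ⟨by rw [h.card_upperArcs, hcard], ?_⟩
    have := h.betaValue_le hcard
    rw [Fin.sum_univ_succ]
    simp only [Fin.tail] at hle
    push_cast at hle ⊢
    linarith

/-- Greedy choice of the rightmost cap. Here `CutBound` stands in for realizability, which is not
known in advance for the peeled state. -/
lemma exists_realizes_and_sum_eq {C : CatalanState m n} (hC : C.NoBottomReturns)
    (hcut : C.CutBound) : ∃ b : Fin m → Fin (n + 1), (rowState b).Realizes C ∧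
      ((∑ j, (b j : ℕ) : ℕ) : ℤ) = C.betaValue := by
  induction m with
  | zero => exact ⟨Fin.elim0, hC.realizes _, by simp [hC.betaValue_eq_zero]⟩
  | succ m ih =>
    obtain ⟨b, hb⟩ := hcut.exists_isRightmostCap
    obtain ⟨C', h⟩ := C.exists_isPeeling b hb.cap
    have hC' := h.noBottomReturns hC
    obtain ⟨b', hreal, hsum⟩ := ih hC' (h.cutBound hcut)
    refine ⟨Fin.cons b b', ?_, ?_⟩
    · exact (realizes_iff_of_isPeeling (b := Fin.cons b b') h).2 hreal
    · rw [hb.betaValue_eq h (card_upperArcs_and_sum_le hC' hreal).1, ← hsum, Fin.sum_univ_succ]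
      simp [add_comm]

end CatalanState

end LatticeCrossing

theorem corollary4p10 (m n : ℕ) (C : LatticeCrossing.CatalanState m n)
    (hreal : C.Realizable) (hbot : C.NoBottomReturns) :
    IsGreatest C.markerSums C.beta ∧
      (C.beta : ℤ) = (m : ℤ) * n + (m : ℤ) * ((m : ℤ) - 1) / 2 +
        ∑ a ∈ C.upperArcs, min a.1.iota (1 - a.2.iota) := by
  obtain ⟨b, hb, hsum⟩ :=
    LatticeCrossing.CatalanState.exists_realizes_and_sum_eq hbot hreal.cutBound
  have hgreatest : IsGreatest C.markerSums (∑ j, (b j : ℕ)) := by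
    refine ⟨⟨b, hb, rfl⟩, ?_⟩
    rintro _ ⟨b', hb', rfl⟩
    have := (LatticeCrossing.CatalanState.card_upperArcs_and_sum_le hbot hb').2
    rw [← hsum] at this
    exact_mod_cast this
  have hbeta : C.beta = ∑ j, (b j : ℕ) := hgreatest.csSup_eq
  rw [hbeta]
  exact ⟨hgreatest, hsum⟩
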